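/- Let $d\in\mathbb N$, let $\Omega\subseteq\mathbb R^d$ be open, let $p\in[1,\infty)$, and let $u\in W^{1,p}_0(\Omega)$ (real-valued). Then for every $\varepsilon>0$ there exists a function $u_\varepsilon\colon\mathbb R^d\to\mathbb R$ that is realized by a ReLU network of depth $\lceil\log_2(d+1)\rceil+1$, whose restriction to $\Omega$ belongs to $W^{1,p}_0(\Omega)$, and which satisfies $$\lVert u-u_\varepsilon\rVert_{W^{1,p}(\Omega)}\le\varepsilon .$$ Here $W^{1,p}(\Omega)$ is the space of functions in $L^p(\Omega)$ with weak gradient in $L^p(\Omega)$, normed by $\lVert v\rVert_{W^{1,p}(\Omega)}^p=\int_\Omega|v|^p\,\mathrm dx+\int_\Omega|\nabla v|^p\,\mathrm dx$ with $|\cdot|$ the Euclidean norm, and $W^{1,p}_0(\Omega)$ is the closure of $C_c^\infty(\Omega)$ in $W^{1,p}(\Omega)$. A function $f\colon\mathbb R^d\to\mathbb R$ is realized by a ReLU network of depth $L\ge1$ if there are natural numbers $N_0=d,N_1,\dots,N_{L-1},N_L=1$ and affine maps $T_l\colon\mathbb R^{N_{l-1}}\to\mathbb R^{N_l}$, $l=1,\dots,L$,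 such that $f(x)=T_L(\rho(T_{L-1}(\rho(\cdots\rho(T_1(x))))))$ for all $x\in\mathbb R^d$, where $\rho(t)=\max\{0,t\}$ is applied coordinatewise. -/

import Mathlib

open MeasureTheory TopologicalSpace
open scoped ENNReal Distributions Gradient

/-- `ℝ^d` with the Euclidean norm. -/
abbrev Eucl (d : ℕ) : Type := EuclideanSpace ℝ (Fin d)

/-- `g` is a weak gradient of `u` in the open set `Ω`: both are locally integrable in `Ω`, and
`∫_Ω u ∇φ = - ∫_Ω φ g` (an identity in `ℝ^d`) for every `φ ∈ C_c^∞(Ω)`. -/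
structure IsWeakGradient {d : ℕ} (Ω : Opens (Eucl d)) (u : Eucl d → ℝ) (g : Eucl d → Eucl d) :
    Prop where
  locallyIntegrableOn_fun : LocallyIntegrableOn u (Ω : Set (Eucl d))
  locallyIntegrableOn_grad : LocallyIntegrableOn g (Ω : Set (Eucl d))
  integral_eq : ∀ φ : 𝓓(Ω, ℝ),
    ∫ x in (Ω : Set (Eucl d)), u x • ∇ (φ : Eucl d → ℝ) x
      = - ∫ x in (Ω : Set (Eucl d)), φ x • g x

/-- Weak gradients are unique almost everywhere in `Ω`. -/
theorem IsWeakGradient.ae_eq {d : ℕ} {Ω : Opens (Eucl d)} {u : Eucl d → ℝ}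
    {g h : Eucl d → Eucl d} (hg : IsWeakGradient Ω u g) (hh : IsWeakGradient Ω u h) :
    g =ᵐ[volume.restrict (Ω : Set (Eucl d))] h := by
  have key : ∀ᵐ x ∂(volume : Measure (Eucl d)), x ∈ (Ω : Set (Eucl d)) → (g - h) x = 0 := by
    refine Ω.isOpen.ae_eq_zero_of_integral_contDiff_smul_eq_zero
      (hg.locallyIntegrableOn_grad.sub hh.locallyIntegrableOn_grad) ?_
    intro f hf hc hs
    let φ : 𝓓(Ω, ℝ) := ⟨f, hf, hc, hs⟩
    have e : ∫ x in (Ω : Set (Eucl d)), f x • g x = ∫ x in (Ω : Set (Eucl d)), f x • h x :=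
      neg_injective ((hg.integral_eq φ).symm.trans (hh.integral_eq φ))
    have z : ∀ k : Eucl d → Eucl d, ∀ x, x ∉ (Ω : Set (Eucl d)) → f x • k x = 0 := by
      intro k x hx
      rw [image_eq_zero_of_notMem_tsupport (fun h => hx (hs h)), zero_smul]
    have i : ∀ k : Eucl d → Eucl d, LocallyIntegrableOn k (Ω : Set (Eucl d)) →
        Integrable (fun x => f x • k x) := by
      intro k hk
      have h1 : IntegrableOn k (tsupport f) := hk.integrableOn_compact_subset hs hc
      have h2 : IntegrableOn (fun x => f x • k x) (tsupport f) :=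
        h1.continuousOn_smul hf.continuous.continuousOn hc
      exact (integrableOn_iff_integrable_of_support_subset
        ((Function.support_smul_subset_left f k).trans (subset_tsupport f))).1 h2
    simp only [Pi.sub_apply, smul_sub]
    rw [integral_sub (i g hg.locallyIntegrableOn_grad) (i h hh.locallyIntegrableOn_grad),
      ← setIntegral_eq_integral_of_forall_compl_eq_zero (z g),
      ← setIntegral_eq_integral_of_forall_compl_eq_zero (z h), e, sub_self]
  rw [Filter.EventuallyEq, ae_restrict_iff' Ω.isOpen.measurableSet]
  filter_upwards [key] with x hx hxΩ
  exact sub_eq_zero.1 (hx hxΩ)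

open Classical in
/-- The weak gradient of `u` in `Ω` (a choice of representative, unique almost everywhere in `Ω`);
it is only used for weakly differentiable `u`, and is `0` by convention otherwise. -/
noncomputable def weakGradient {d : ℕ} (Ω : Opens (Eucl d)) (u : Eucl d → ℝ) :
    Eucl d → Eucl d :=
  if h : ∃ g, IsWeakGradient Ω u g then h.choose else 0

/-- `u ∈ W^{1,p}(Ω)`: `u` lies in `L^p(Ω)`, has a weak gradient, and that gradient lies in
`L^p(Ω)`. Only the values of `u` in `Ω` matter. -/
structure MemW1p {d : ℕ} (Ω : Opens (Eucl d)) (p : ℝ≥0∞) (u : Eucl d → ℝ) : Prop where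
  memLp : MemLp u p (volume.restrict (Ω : Set (Eucl d)))
  exists_weakGradient : ∃ g, IsWeakGradient Ω u g
  memLp_weakGradient : MemLp (weakGradient Ω u) p (volume.restrict (Ω : Set (Eucl d)))

/-- The norm `(‖u‖_{L^p(Ω)}^p + ‖∇u‖_{L^p(Ω)}^p)^{1/p}` of `u ∈ W^{1,p}(Ω)`, for finite `p`. -/
noncomputable def w1pNorm {d : ℕ} (Ω : Opens (Eucl d)) (p : ℝ≥0∞) (u : Eucl d → ℝ) : ℝ≥0∞ :=
  (eLpNorm u p (volume.restrict (Ω : Set (Eucl d))) ^ p.toReal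
    + eLpNorm (weakGradient Ω u) p (volume.restrict (Ω : Set (Eucl d))) ^ p.toReal)
      ^ (1 / p.toReal)

/-- `u ∈ W^{1,p}_0(Ω)`: `u` lies in the closure of `C_c^∞(Ω)` in `W^{1,p}(Ω)`. -/
structure MemW01p {d : ℕ} (Ω : Opens (Eucl d)) (p : ℝ≥0∞) (u : Eucl d → ℝ) : Prop where
  memW1p : MemW1p Ω p u
  mem_closure : ∀ ε : ℝ, 0 < ε →
    ∃ φ : 𝓓(Ω, ℝ), w1pNorm Ω p (u - (φ : Eucl d → ℝ)) < ENNReal.ofReal ε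

/-- `NetworkParams L n m`: parameters `((A₁, b₁), …, (A_L, b_L))` of a feedforward network of
depth `L ≥ 1` (the number of affine maps) with input dimension `n`, output dimension `m` and
arbitrary hidden widths. -/
inductive NetworkParams : ℕ → ℕ → ℕ → Type
  | output {n m : ℕ} (A : Matrix (Fin m) (Fin n) ℝ) (b : Fin m → ℝ) : NetworkParams 1 n m
  | layer {L n k m : ℕ} (A : Matrix (Fin k) (Fin n) ℝ) (b : Fin k → ℝ)
      (θ : NetworkParams L k m) : NetworkParams (L + 1) n m

/-- The network function `x ↦ T_L(ρ(T_{L-1}(ρ(⋯ρ(T₁ x)))))` with `T_l y = A_l y + b_l` and the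
activation `ρ` applied coordinatewise. -/
def NetworkParams.eval (ρ : ℝ → ℝ) :
    {L n m : ℕ} → NetworkParams L n m → (Fin n → ℝ) → (Fin m → ℝ)
  | _, _, _, .output A b, x => A.mulVec x + b
  | _, _, _, .layer A b θ, x => θ.eval ρ (fun i => ρ ((A.mulVec x + b) i))

/-- The ReLU activation function. -/
noncomputable def relu (x : ℝ) : ℝ := max 0 x

/-- `f : ℝ^d → ℝ` is realized by a ReLU network of depth (exactly) `L`. -/
def RealizedByReLU {d : ℕ} (L : ℕ) (f : Eucl d → ℝ) : Prop :=
  ∃ θ : NetworkParams L d 1, ∀ x : Eucl d, f x = θ.eval relu x.ofLp 0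

/-! By density it suffices to approximate a test function φ in W^{1,p} by a difference f of two
maxima of finitely many affine functions, with compact support in Ω. Such an f is Lipschitz, hence
lies in W^{1,p}_0(Ω) by mollification (`LipschitzWith.memW01p`), and it is a network function of the
right depth.

Depth: among at least d + 2 affine functions on ℝ^d, a linear dependence lets inclusion-exclusion
express the maximum through maxima of fewer of them; iterating leaves maxima of at most d + 1
(`maxAffine_mem_span`). Each of these is a knockout tournament with ⌈log₂(d+1)⌉ rounds, one hidden
layer per round, and linear combinations cost no extra layer (`exists_network_sum_iSup`).

Approximation: no triangulation is used. If |D²φ| ≤ K, then φ + 2K|x|² is uniformly convex, and the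
maximum of its tangents at an h-net is O(h²)-close in value and O(h)-close in gradient. Subtracting
the same construction for φ = 0 cancels the quadratic. Only tangents at points near x are active at
x, so where the net is fine the difference vanishes exactly away from the support of φ. Clipping by
a compactly supported piecewise affine cutoff removes what is left far out
(`TestFunction.exists_isMaxAffineDiff_approx`). -/

/-! ### Maxima of finitely many affine functions -/

/-- The affine function `x ↦ ⟨a, x⟩ + b` with parameters `s = (a, b)`. -/
noncomputable def affineVal {d : ℕ} (s : Eucl d × ℝ) (x : Eucl d) : ℝ := inner ℝ s.1 x + s.2

/-- The maximum of the affine functions with parameters in `S` (and `0` if `S` is empty). -/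
noncomputable def maxAffine {d : ℕ} (S : Finset (Eucl d × ℝ)) (x : Eucl d) : ℝ :=
  if h : S.Nonempty then S.sup' h (fun s => affineVal s x) else 0

section maxAffine

variable {d : ℕ} {S T : Finset (Eucl d × ℝ)}

theorem affineVal_le_maxAffine {s : Eucl d × ℝ} (hs : s ∈ S) (x : Eucl d) :
    affineVal s x ≤ maxAffine S x := by
  rw [maxAffine, dif_pos ⟨s, hs⟩]
  exact Finset.le_sup' (fun s => affineVal s x) hs

theorem exists_maxAffine_eq (hS : S.Nonempty) (x : Eucl d) :
    ∃ s ∈ S, maxAffine S x = affineVal s x := by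
  rw [maxAffine, dif_pos hS]
  exact Finset.exists_mem_eq_sup' hS _

theorem maxAffine_le (hS : S.Nonempty) {x : Eucl d} {r : ℝ}
    (h : ∀ s ∈ S, affineVal s x ≤ r) : maxAffine S x ≤ r := by
  obtain ⟨s, hs, e⟩ := exists_maxAffine_eq hS x
  exact e ▸ h s hs

theorem maxAffine_eq_of_forall_le {x : Eucl d} {s : Eucl d × ℝ} (hs : s ∈ S)
    (h : ∀ t ∈ S, affineVal t x ≤ affineVal s x) : maxAffine S x = affineVal s x :=
  le_antisymm (maxAffine_le ⟨s, hs⟩ h) (affineVal_le_maxAffine hs x)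

theorem maxAffine_singleton (s : Eucl d × ℝ) (x : Eucl d) :
    maxAffine {s} x = affineVal s x :=
  maxAffine_eq_of_forall_le (Finset.mem_singleton_self s)
    fun _ ht => (Finset.mem_singleton.1 ht ▸ le_rfl)

theorem lipschitzWith_affineVal (s : Eucl d × ℝ) : LipschitzWith ‖s.1‖₊ (affineVal s) := by
  refine LipschitzWith.of_dist_le_mul fun x y => ?_
  rw [Real.dist_eq, dist_eq_norm, affineVal, affineVal, add_sub_add_right_eq_sub, ← inner_sub_right]
  exact abs_real_inner_le_norm _ _

theorem exists_lipschitzWith_maxAffine (hS : S.Nonempty) :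
    ∃ C, LipschitzWith C (maxAffine S) := by
  refine ⟨S.sup fun s => ‖s.1‖₊, LipschitzWith.of_le_add_mul _ fun x y => ?_⟩
  refine maxAffine_le hS fun s hs => ?_
  have h := ((lipschitzWith_affineVal s).weaken
    (Finset.le_sup (f := fun s : Eucl d × ℝ => ‖s.1‖₊) hs)).le_add_mul x y
  have := affineVal_le_maxAffine hs y
  linarith

open Classical in
theorem maxAffine_union (hS : S.Nonempty) (hT : T.Nonempty) (x : Eucl d) :
    maxAffine (S ∪ T) x = max (maxAffine S x) (maxAffine T x) := by
  refine le_antisymm (maxAffine_le (hS.mono Finset.subset_union_left) fun s hs => ?_)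
    (max_le (maxAffine_le hS fun s hs => ?_) (maxAffine_le hT fun s hs => ?_))
  · rcases Finset.mem_union.1 hs with h | h
    · exact le_max_of_le_left (affineVal_le_maxAffine h x)
    · exact le_max_of_le_right (affineVal_le_maxAffine h x)
  · exact affineVal_le_maxAffine (Finset.mem_union_left _ hs) x
  · exact affineVal_le_maxAffine (Finset.mem_union_right _ hs) x

theorem affineVal_add (s t : Eucl d × ℝ) (x : Eucl d) :
    affineVal (s + t) x = affineVal s x + affineVal t x := by
  simp only [affineVal, Prod.fst_add, Prod.snd_add, inner_add_left]
  ring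

open Classical Pointwise in
theorem maxAffine_add (hS : S.Nonempty) (hT : T.Nonempty) (x : Eucl d) :
    maxAffine (S + T) x = maxAffine S x + maxAffine T x := by
  obtain ⟨s, hs, es⟩ := exists_maxAffine_eq hS x
  obtain ⟨t, ht, et⟩ := exists_maxAffine_eq hT x
  rw [es, et, ← affineVal_add]
  refine maxAffine_eq_of_forall_le (Finset.add_mem_add hs ht) fun r hr => ?_
  obtain ⟨s', hs', t', ht', rfl⟩ := Finset.mem_add.1 hr
  rw [affineVal_add, affineVal_add, ← es, ← et]
  exact add_le_add (affineVal_le_maxAffine hs' x) (affineVal_le_maxAffine ht' x)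

/-- Inclusion-exclusion: if `P ⊆ S` and at every point the smallest of the values in `P` is
dominated by some value in `S \ P`, then the alternating sum of the maxima over `S \ T`, `T ⊆ P`,
vanishes. -/
theorem sum_powerset_maxAffine_sdiff [DecidableEq (Eucl d × ℝ)] {P : Finset (Eucl d × ℝ)}
    (x : Eucl d) {i : Eucl d × ℝ} (hi : i ∈ P)
    (h : ∃ s ∈ S, s ∉ P ∧ affineVal i x ≤ affineVal s x) :
    ∑ T ∈ P.powerset, (-1 : ℝ) ^ T.card * maxAffine (S \ T) x = 0 := by
  obtain ⟨s, hs, hsP, his⟩ := h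
  -- The sets `T` without `i` are paired with `insert i T`: the signs are opposite, and the maxima
  -- agree because `s` is never removed and dominates `i`.
  rw [← Finset.insert_erase hi, Finset.sum_powerset_insert (Finset.notMem_erase i P),
    ← Finset.sum_add_distrib]
  refine Finset.sum_eq_zero fun T hT => ?_
  have hTP : T ⊆ P.erase i := Finset.mem_powerset.1 hT
  have hiT : i ∉ T := fun h => Finset.notMem_erase i P (hTP h)
  have hsT : s ∉ T := fun h => hsP (Finset.mem_of_mem_erase (hTP h))
  have hsi : s ≠ i := fun h => hsP (h ▸ hi)
  have key : maxAffine (S \ insert i T) x = maxAffine (S \ T) x := by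
    refine le_antisymm (maxAffine_le ⟨s, ?_⟩ fun r hr => affineVal_le_maxAffine ?_ x)
      (maxAffine_le ⟨s, ?_⟩ fun r hr => ?_)
    · simp [hs, hsT, hsi]
    · simp only [Finset.mem_sdiff, Finset.mem_insert, not_or] at hr ⊢
      exact ⟨hr.1, hr.2.2⟩
    · simp [hs, hsT]
    · by_cases hri : r = i
      · rw [hri]
        exact his.trans (affineVal_le_maxAffine (by simp [hs, hsT, hsi]) x)
      · refine affineVal_le_maxAffine ?_ x
        simp only [Finset.mem_sdiff, Finset.mem_insert, not_or] at hr ⊢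
        exact ⟨hr.1, hri, hr.2⟩
  rw [Finset.card_insert_of_notMem hiT, key, pow_succ]
  ring

/-- Among at least `d + 2` affine functions on `ℝ^d` some subfamily `P` has, at each
point, a member lying below some function outside of `P`. -/
theorem exists_subfamily_dominated (hS : d + 1 < S.card) :
    ∃ P ⊆ S, ∀ x, ∃ i ∈ P, ∃ s ∈ S, s ∉ P ∧ affineVal i x ≤ affineVal s x := by
  classical
  -- The vectors (a, 1) live in dimension d + 1, so more than d + 1 of them are dependent. The
  -- relation makes `∑ g i * affineVal i x` independent of `x`.
  have hdep : ¬ LinearIndependent ℝ (fun s : S => ((s : Eucl d × ℝ).1, (1 : ℝ))) := by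
    intro h
    have := h.fintype_card_le_finrank
    rw [Module.finrank_prod, finrank_euclideanSpace, Module.finrank_self, Fintype.card_fin,
      Fintype.card_coe] at this
    omega
  obtain ⟨g, hg, i₀, hi₀⟩ := Fintype.not_linearIndependent_iff.1 hdep
  obtain ⟨hg1, hg2⟩ := Prod.ext_iff.1 hg
  simp only [Prod.fst_sum, Prod.snd_sum, Prod.smul_fst, Prod.smul_snd, Prod.fst_zero,
    Prod.snd_zero, smul_eq_mul, mul_one] at hg1 hg2
  -- after a change of sign, the relation reads `∑ g i * ℓ i ≤ 0`
  obtain ⟨g, hg1, hg2, hg3, hi₀⟩ : ∃ g : S → ℝ, ∑ i, g i • (i : Eucl d × ℝ).1 = 0 ∧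
      ∑ i, g i = 0 ∧ ∑ i, g i * (i : Eucl d × ℝ).2 ≤ 0 ∧ ∃ i, g i ≠ 0 := by
    rcases le_total (∑ i, g i * (i : Eucl d × ℝ).2) 0 with h | h
    · exact ⟨g, hg1, hg2, h, i₀, hi₀⟩
    · refine ⟨-g, ?_, ?_, ?_, i₀, by simpa using hi₀⟩
      · simp only [Pi.neg_apply, neg_smul, Finset.sum_neg_distrib, hg1, neg_zero]
      · simp only [Pi.neg_apply, Finset.sum_neg_distrib, hg2, neg_zero]
      · simpa using h
  have hpos : ∃ i, 0 < g i := by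
    by_contra! hle
    obtain ⟨i, hi⟩ := hi₀
    exact hi ((Finset.sum_eq_zero_iff_of_nonpos fun i _ => hle i).1 hg2 i (Finset.mem_univ i))
  obtain ⟨i₁, hi₁⟩ := hpos
  -- `P` consists of the members with positive coefficient. If all its values exceeded all values
  -- outside, a combination of total weight zero would be positive, yet it is a constant ≤ 0.
  refine ⟨(Finset.univ.filter fun i => 0 < g i).map (Function.Embedding.subtype _), ?_,
    fun x => ?_⟩
  · intro s hs
    obtain ⟨t, -, rfl⟩ := Finset.mem_map.1 hs
    exact t.2
  · by_contra! hcon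
    have hval : ∑ i, g i * affineVal (i : Eucl d × ℝ) x ≤ 0 := by
      have : ∑ i, g i * affineVal (i : Eucl d × ℝ) x
          = inner ℝ (∑ i, g i • (i : Eucl d × ℝ).1) x + ∑ i, g i * (i : Eucl d × ℝ).2 := by
        simp only [affineVal, sum_inner, inner_smul_left, mul_add, Finset.sum_add_distrib]
        simp
      rw [this, hg1, inner_zero_left, zero_add]
      exact hg3
    have hlt : ∀ i j : S, 0 < g i → g j ≤ 0 →
        affineVal (j : Eucl d × ℝ) x < affineVal (i : Eucl d × ℝ) x := by
      intro i j hi hj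
      exact hcon i (by simp [hi]) j j.2 (by simp [hj])
    -- the least value over `P`
    obtain ⟨m, hm, hmin⟩ := Finset.exists_min_image (Finset.univ.filter fun i => 0 < g i)
      (fun i : S => affineVal (i : Eucl d × ℝ) x) ⟨i₁, by simp [hi₁]⟩
    have hm' : 0 < g m := (Finset.mem_filter.1 hm).2
    have hterm : ∀ i, 0 ≤ g i * (affineVal (i : Eucl d × ℝ) x - affineVal (m : Eucl d × ℝ) x) := by
      intro i
      rcases lt_or_ge 0 (g i) with h | h
      · exact mul_nonneg h.le (sub_nonneg.2 (hmin i (by simp [h])))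
      · exact mul_nonneg_of_nonpos_of_nonpos h (sub_nonpos.2 (hlt m i hm' h).le)
    have hsum : ∑ i, g i * (affineVal (i : Eucl d × ℝ) x - affineVal (m : Eucl d × ℝ) x) ≤ 0 := by
      simp only [mul_sub, Finset.sum_sub_distrib, ← Finset.sum_mul, hg2]
      simpa using hval
    have hneg : ∃ j, g j < 0 := by
      by_contra! hge
      have := (Finset.sum_eq_zero_iff_of_nonneg fun i _ => hge i).1 hg2 m (Finset.mem_univ m)
      exact hm'.ne' this
    obtain ⟨j, hj⟩ := hneg
    have h0 := (Finset.sum_eq_zero_iff_of_nonneg fun i _ => hterm i).1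
      (le_antisymm hsum (Finset.sum_nonneg fun i _ => hterm i)) j (Finset.mem_univ j)
    have := mul_pos_of_neg_of_neg hj (sub_neg.2 (hlt m j hm' hj.le))
    exact this.ne' h0

/-- Every maximum of finitely many affine functions on `ℝ^d` is a linear combination of maxima of at
most `d + 1` affine functions. -/
theorem maxAffine_mem_span (hS : S.Nonempty) :
    maxAffine S ∈ Submodule.span ℝ
      {f | ∃ T : Finset (Eucl d × ℝ), T.Nonempty ∧ T.card ≤ d + 1 ∧ f = maxAffine T} := by
  classical
  induction S using Finset.strongInduction with
  | H S ih =>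
    rcases le_or_gt S.card (d + 1) with hc | hc
    · exact Submodule.subset_span ⟨S, hS, hc, rfl⟩
    · obtain ⟨P, hPS, hP⟩ := exists_subfamily_dominated hc
      have hout : ∃ s ∈ S, s ∉ P := by
        obtain ⟨i, -, s, hs, hsP, -⟩ := hP 0
        exact ⟨s, hs, hsP⟩
      obtain ⟨s, hs, hsP⟩ := hout
      -- The term `T = ∅` is `maxAffine S` itself; all others are maxima over strictly smaller sets,
      -- nonempty since `s` survives.
      have e : maxAffine S
          = -∑ T ∈ P.powerset.erase ∅, (-1 : ℝ) ^ T.card • maxAffine (S \ T) := by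
        funext x
        obtain ⟨i, hi, h⟩ := hP x
        have h0 := sum_powerset_maxAffine_sdiff x hi h
        rw [← Finset.add_sum_erase _ _ (Finset.empty_mem_powerset P)] at h0
        simp only [Finset.card_empty, pow_zero, one_mul, Finset.sdiff_empty] at h0
        simp only [Pi.neg_apply, Finset.sum_apply, Pi.smul_apply, smul_eq_mul]
        linarith
      rw [e]
      refine Submodule.neg_mem _ (Submodule.sum_mem _ fun T hT => Submodule.smul_mem _ _ ?_)
      obtain ⟨hT0, hTP⟩ := Finset.mem_erase.1 hT
      rw [Finset.mem_powerset] at hTP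
      obtain ⟨t, ht⟩ := Finset.nonempty_iff_ne_empty.2 hT0
      refine ih _ ?_ ⟨s, Finset.mem_sdiff.2 ⟨hs, fun h => hsP (hTP h)⟩⟩
      refine Finset.ssubset_iff_subset_ne.2 ⟨Finset.sdiff_subset, fun h => ?_⟩
      have : t ∈ S \ T := by rw [h]; exact hPS (hTP ht)
      exact (Finset.mem_sdiff.1 this).2 ht

end maxAffine

/-! ### Differences of maxima of affine functions -/

/-- `f` is a difference of two maxima of finitely many affine functions. -/
def IsMaxAffineDiff {d : ℕ} (f : Eucl d → ℝ) : Prop :=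
  ∃ S T : Finset (Eucl d × ℝ), S.Nonempty ∧ T.Nonempty ∧ ∀ x, f x = maxAffine S x - maxAffine T x

namespace IsMaxAffineDiff

variable {d : ℕ} {f g : Eucl d → ℝ}

theorem affine (s : Eucl d × ℝ) : IsMaxAffineDiff (affineVal s) :=
  ⟨{s}, {0}, ⟨s, by simp⟩, ⟨0, by simp⟩, fun x => by
    rw [maxAffine_singleton, maxAffine_singleton]
    simp [affineVal]⟩

theorem const (c : ℝ) : IsMaxAffineDiff (fun _ : Eucl d => c) := by
  have h := affine ((0, c) : Eucl d × ℝ)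
  have e : affineVal ((0, c) : Eucl d × ℝ) = fun _ => c := by
    funext x
    simp [affineVal]
  rwa [e] at h

theorem neg (hf : IsMaxAffineDiff f) : IsMaxAffineDiff (fun x => -f x) := by
  obtain ⟨S, T, hS, hT, h⟩ := hf
  exact ⟨T, S, hT, hS, fun x => by simp only [h]; ring⟩

theorem add (hf : IsMaxAffineDiff f) (hg : IsMaxAffineDiff g) :
    IsMaxAffineDiff (fun x => f x + g x) := by
  classical
  open Pointwise in
  obtain ⟨S, T, hS, hT, h⟩ := hf
  obtain ⟨S', T', hS', hT', h'⟩ := hg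
  refine ⟨S + S', T + T', hS.add hS', hT.add hT', fun x => ?_⟩
  simp only [maxAffine_add hS hS', maxAffine_add hT hT', h, h']
  ring

theorem sub (hf : IsMaxAffineDiff f) (hg : IsMaxAffineDiff g) :
    IsMaxAffineDiff (fun x => f x - g x) := by
  simpa only [sub_eq_add_neg] using hf.add hg.neg

/-- max(a − b, a' − b') = max(a + b', a' + b) − (b + b'), and convex maxima are closed under sums
and maxima. -/
theorem max (hf : IsMaxAffineDiff f) (hg : IsMaxAffineDiff g) :
    IsMaxAffineDiff (fun x => max (f x) (g x)) := by
  classical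
  open Pointwise in
  obtain ⟨S, T, hS, hT, h⟩ := hf
  obtain ⟨S', T', hS', hT', h'⟩ := hg
  refine ⟨(S + T') ∪ (S' + T), T + T', (hS.add hT').mono Finset.subset_union_left,
    hT.add hT', fun x => ?_⟩
  rw [maxAffine_union (hS.add hT') (hS'.add hT), maxAffine_add hS hT', maxAffine_add hS' hT,
    maxAffine_add hT hT', ← max_sub_sub_right]
  simp only [h, h']
  congr 1 <;> ring

theorem min (hf : IsMaxAffineDiff f) (hg : IsMaxAffineDiff g) :
    IsMaxAffineDiff (fun x => min (f x) (g x)) := by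
  have h := (hf.neg.max hg.neg).neg
  simpa only [max_neg_neg, neg_neg] using h

theorem sum {ι : Type*} (s : Finset ι) {F : ι → Eucl d → ℝ}
    (hF : ∀ i ∈ s, IsMaxAffineDiff (F i)) : IsMaxAffineDiff (fun x => ∑ i ∈ s, F i x) := by
  classical
  induction s using Finset.induction_on with
  | empty => simpa using const 0
  | insert i s hi ih =>
    simp only [Finset.sum_insert hi]
    exact (hF i (Finset.mem_insert_self i s)).add
      (ih fun j hj => hF j (Finset.mem_insert_of_mem hj))

theorem exists_lipschitzWith (hf : IsMaxAffineDiff f) : ∃ C, LipschitzWith C f := by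
  obtain ⟨S, T, hS, hT, h⟩ := hf
  obtain ⟨C, hC⟩ := exists_lipschitzWith_maxAffine hS
  obtain ⟨D, hD⟩ := exists_lipschitzWith_maxAffine hT
  exact ⟨C + D, (funext h : f = _) ▸ hC.sub hD⟩

theorem mem_span (hf : IsMaxAffineDiff f) :
    f ∈ Submodule.span ℝ
      {f | ∃ T : Finset (Eucl d × ℝ), T.Nonempty ∧ T.card ≤ d + 1 ∧ f = maxAffine T} := by
  obtain ⟨S, T, hS, hT, h⟩ := hf
  exact (funext h : f = maxAffine S - maxAffine T) ▸
    Submodule.sub_mem _ (maxAffine_mem_span hS) (maxAffine_mem_span hT)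

end IsMaxAffineDiff

/-! ### Realization by ReLU networks -/

/-- One match costs three neurons; the last two carry `b` through the activation. -/
theorem max_eq_relu (a b : ℝ) : max a b = relu (a - b) + relu b - relu (-b) := by
  unfold relu
  rcases le_total a b with h | h <;> rcases le_total 0 b with h' | h' <;>
    simp [h, h']

/-- One tournament round: entries that differ only in the first bit are matched. -/
theorem iSup_fin_succ_bool {k : ℕ} (f : (Fin (k + 1) → Bool) → ℝ) :
    ⨆ v, f v = ⨆ w : Fin k → Bool, max (f (Fin.cons true w)) (f (Fin.cons false w)) := by
  refine le_antisymm (ciSup_le fun v => ?_) (ciSup_le fun w => max_le ?_ ?_)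
  · refine le_trans ?_ (le_ciSup (Set.finite_range _).bddAbove (Fin.tail v))
    rw [← Fin.cons_self_tail v]
    cases v 0
    · simp
    · simp
  · exact le_ciSup (Set.finite_range f).bddAbove _
  · exact le_ciSup (Set.finite_range f).bddAbove _

/-- Linear combinations of maxima of `2 ^ k` affine functions are realized by ReLU networks of
depth `k + 1`. -/
theorem exists_network_sum_iSup (k : ℕ) : ∀ {n : ℕ} {J : Type} [Fintype J] (c : J → ℝ)
    (A : J → (Fin k → Bool) → Fin n → ℝ) (b : J → (Fin k → Bool) → ℝ),
    ∃ θ : NetworkParams (k + 1) n 1, ∀ x,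
      θ.eval relu x 0 = ∑ j, c j * ⨆ v, (A j v ⬝ᵥ x + b j v) := by
  classical
  induction k with
  | zero =>
    intro n J _ c A b
    refine ⟨.output (fun _ => ∑ j, c j • A j default) (fun _ => ∑ j, c j * b j default), ?_⟩
    intro x
    simp only [NetworkParams.eval, Pi.add_apply, Matrix.mulVec, sum_dotProduct, smul_dotProduct,
      ← Finset.sum_add_distrib, smul_eq_mul, ← mul_add]
    refine Finset.sum_congr rfl fun j _ => ?_
    rw [ciSup_unique, Subsingleton.elim (Unique.instInhabited.default : Fin 0 → Bool) default]
  | succ k ih =>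
    intro n J _ c A b
    let I := J × (Fin k → Bool) × Fin 3
    let e : I ≃ Fin (Fintype.card I) := Fintype.equivFin I
    let W : I → Fin n → ℝ := fun i =>
      ![A i.1 (Fin.cons true i.2.1) - A i.1 (Fin.cons false i.2.1),
        A i.1 (Fin.cons false i.2.1), -A i.1 (Fin.cons false i.2.1)] i.2.2
    let β : I → ℝ := fun i =>
      ![b i.1 (Fin.cons true i.2.1) - b i.1 (Fin.cons false i.2.1),
        b i.1 (Fin.cons false i.2.1), -b i.1 (Fin.cons false i.2.1)] i.2.2
    -- The recombination of three neurons into a maximum is linear, so the next affine map absorbs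
    -- it and each round costs exactly one layer.
    obtain ⟨θ, hθ⟩ := ih c
      (fun j w => Pi.single (e (j, w, 0)) 1 + Pi.single (e (j, w, 1)) 1
        - Pi.single (e (j, w, 2)) 1) (fun _ _ => 0)
    refine ⟨.layer (fun i => W (e.symm i)) (fun i => β (e.symm i)) θ, fun x => ?_⟩
    refine (hθ _).trans ?_
    refine Finset.sum_congr rfl fun j _ => ?_
    rw [iSup_fin_succ_bool]
    congr 1
    refine iSup_congr fun w => ?_
    rw [max_eq_relu]
    simp only [sub_dotProduct, add_dotProduct, single_dotProduct, one_mul, add_zero,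
      Pi.add_apply, Matrix.mulVec, e, Equiv.symm_apply_apply, W, β]
    simp only [Matrix.cons_val_zero, Matrix.cons_val_one, Matrix.cons_val, sub_dotProduct,
      neg_dotProduct]
    congr 3 <;> ring

/-- Unused tournament slots are filled by repeating members of `T`, so the depth is exact even for
small families. -/
theorem exists_iSup_eq_maxAffine {d k : ℕ} {T : Finset (Eucl d × ℝ)} (hT : T.Nonempty)
    (hk : T.card ≤ 2 ^ k) :
    ∃ g : (Fin k → Bool) → Eucl d × ℝ, ∀ x, ⨆ v, affineVal (g v) x = maxAffine T x := by
  classical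
  have : Nonempty T := hT.to_subtype
  obtain ⟨i⟩ : Nonempty (T ↪ (Fin k → Bool)) :=
    Function.Embedding.nonempty_of_card_le (by simpa using hk)
  refine ⟨fun v => (Function.invFun i v : T), fun x => le_antisymm ?_ ?_⟩
  · exact ciSup_le fun v => affineVal_le_maxAffine (Subtype.coe_prop _) x
  · refine maxAffine_le hT fun s hs => ?_
    have := le_ciSup (f := fun v => affineVal ((Function.invFun i v : T) : Eucl d × ℝ) x)
      (Set.finite_range _).bddAbove (i ⟨s, hs⟩)
    simpa only [Function.leftInverse_invFun i.injective ⟨s, hs⟩] using this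

theorem le_two_pow_ceil_logb (n : ℕ) : n + 1 ≤ 2 ^ ⌈Real.logb 2 ((n : ℝ) + 1)⌉₊ := by
  have h : (n : ℝ) + 1 ≤ (2 : ℝ) ^ (⌈Real.logb 2 ((n : ℝ) + 1)⌉₊ : ℝ) :=
    (Real.logb_le_iff_le_rpow one_lt_two (by positivity)).1 (Nat.le_ceil _)
  rw [Real.rpow_natCast] at h
  exact_mod_cast h

theorem IsMaxAffineDiff.realizedByReLU {d : ℕ} {f : Eucl d → ℝ} (hf : IsMaxAffineDiff f) :
    RealizedByReLU (⌈Real.logb 2 ((d : ℝ) + 1)⌉₊ + 1) f := by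
  classical
  obtain ⟨m, c, F, hF⟩ := Submodule.mem_span_set'.1 hf.mem_span
  choose T hTne hTc hTF using fun i => (F i).2
  choose g hg using fun i =>
    exists_iSup_eq_maxAffine (hTne i) ((hTc i).trans (le_two_pow_ceil_logb d))
  obtain ⟨θ, hθ⟩ := exists_network_sum_iSup _ c (fun i v => (g i v).1.ofLp) (fun i v => (g i v).2)
  refine ⟨θ, fun x => ?_⟩
  rw [hθ, ← hF, Finset.sum_apply]
  refine Finset.sum_congr rfl fun i _ => ?_
  rw [Pi.smul_apply, hTF i, ← hg i x, smul_eq_mul]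
  congr 1
  refine iSup_congr fun v => ?_
  rw [affineVal, EuclideanSpace.inner_eq_star_dotProduct, dotProduct_comm]
  simp

/-! ### Gradients of Lipschitz functions -/

section gradient

variable {d : ℕ} {f g : Eucl d → ℝ}

theorem inner_gradient (f : Eucl d → ℝ) (x v : Eucl d) : inner ℝ v (∇ f x) = fderiv ℝ f x v := by
  rw [real_inner_comm, gradient, InnerProductSpace.toDual_symm_apply]

theorem norm_gradient (f : Eucl d → ℝ) (x : Eucl d) : ‖∇ f x‖ = ‖fderiv ℝ f x‖ :=
  (InnerProductSpace.toDual ℝ (Eucl d)).symm.norm_map _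

theorem norm_gradient_sub_gradient (f g : Eucl d → ℝ) (x : Eucl d) :
    ‖∇ f x - ∇ g x‖ = ‖fderiv ℝ f x - fderiv ℝ g x‖ := by
  rw [gradient, gradient, ← map_sub]
  exact (InnerProductSpace.toDual ℝ (Eucl d)).symm.norm_map _

theorem measurable_gradient (f : Eucl d → ℝ) : Measurable (∇ f) :=
  (InnerProductSpace.toDual ℝ (Eucl d)).symm.continuous.measurable.comp (measurable_fderiv ℝ f)

theorem tsupport_gradient_subset (f : Eucl d → ℝ) : tsupport (∇ f) ⊆ tsupport f := by
  refine (closure_mono fun x hx => ?_).trans (tsupport_fderiv_subset ℝ (f := f))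
  rw [Function.mem_support] at hx ⊢
  rwa [← norm_ne_zero_iff, ← norm_gradient, norm_ne_zero_iff]

theorem LipschitzWith.norm_gradient_le {C : NNReal} (hf : LipschitzWith C f) (x : Eucl d) :
    ‖∇ f x‖ ≤ C :=
  (norm_gradient f x).trans_le (norm_fderiv_le_of_lipschitz ℝ hf)

theorem LipschitzWith.memLp_gradient {C : NNReal} (hf : LipschitzWith C f)
    (hc : HasCompactSupport f) (p : ℝ≥0∞) : MemLp (∇ f) p := by
  have h : HasCompactSupport (∇ f) := hc.of_isClosed_subset (isClosed_tsupport _)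
    (tsupport_gradient_subset f)
  exact h.memLp_of_bound (measurable_gradient f).aestronglyMeasurable C
    (Filter.Eventually.of_forall hf.norm_gradient_le)

theorem TestFunction.exists_lipschitzWith {Ω : Opens (Eucl d)} (φ : 𝓓(Ω, ℝ)) :
    ∃ C, LipschitzWith C (φ : Eucl d → ℝ) :=
  φ.contDiff.lipschitzWith_of_hasCompactSupport φ.hasCompactSupport (by simp)

end gradient

/-! ### Weak gradients -/

section weak

variable {d : ℕ} {Ω : Opens (Eucl d)}

theorem integrableOn_smul_gradient {u : Eucl d → ℝ} (hu : LocallyIntegrableOn u (Ω : Set (Eucl d)))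
    (φ : 𝓓(Ω, ℝ)) :
    IntegrableOn (fun x => u x • ∇ (φ : Eucl d → ℝ) x) (Ω : Set (Eucl d)) := by
  have h1 : IntegrableOn u (tsupport φ) :=
    hu.integrableOn_compact_subset φ.tsupport_subset φ.hasCompactSupport
  have hcont : Continuous (∇ (φ : Eucl d → ℝ)) :=
    (InnerProductSpace.toDual ℝ (Eucl d)).symm.continuous.comp
      (φ.contDiff.continuous_fderiv (by simp))
  have h2 : IntegrableOn (fun x => u x • ∇ (φ : Eucl d → ℝ) x) (tsupport φ) :=
    h1.smul_continuousOn hcont.continuousOn φ.hasCompactSupport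
  exact ((integrableOn_iff_integrable_of_support_subset
    ((Function.support_smul_subset_right u (∇ (φ : Eucl d → ℝ))).trans
      ((subset_tsupport _).trans (tsupport_gradient_subset _)))).1 h2).integrableOn

theorem integrableOn_testFunction_smul {g : Eucl d → Eucl d}
    (hg : LocallyIntegrableOn g (Ω : Set (Eucl d))) (φ : 𝓓(Ω, ℝ)) :
    IntegrableOn (fun x => φ x • g x) (Ω : Set (Eucl d)) := by
  have h1 : IntegrableOn g (tsupport φ) :=
    hg.integrableOn_compact_subset φ.tsupport_subset φ.hasCompactSupport
  have h2 : IntegrableOn (fun x => φ x • g x) (tsupport φ) :=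
    h1.continuousOn_smul φ.continuous.continuousOn φ.hasCompactSupport
  exact ((integrableOn_iff_integrable_of_support_subset
    ((Function.support_smul_subset_left φ g).trans (subset_tsupport _))).1 h2).integrableOn

theorem IsWeakGradient.sub {u v : Eucl d → ℝ} {g h : Eucl d → Eucl d}
    (hu : IsWeakGradient Ω u g) (hv : IsWeakGradient Ω v h) :
    IsWeakGradient Ω (u - v) (g - h) where
  locallyIntegrableOn_fun := hu.locallyIntegrableOn_fun.sub hv.locallyIntegrableOn_fun
  locallyIntegrableOn_grad := hu.locallyIntegrableOn_grad.sub hv.locallyIntegrableOn_grad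
  integral_eq φ := by
    simp only [Pi.sub_apply, sub_smul, smul_sub]
    rw [integral_sub (integrableOn_smul_gradient hu.locallyIntegrableOn_fun φ)
        (integrableOn_smul_gradient hv.locallyIntegrableOn_fun φ),
      integral_sub (integrableOn_testFunction_smul hu.locallyIntegrableOn_grad φ)
        (integrableOn_testFunction_smul hv.locallyIntegrableOn_grad φ),
      hu.integral_eq, hv.integral_eq]
    abel

theorem IsWeakGradient.weakGradient_ae_eq {u : Eucl d → ℝ} {g : Eucl d → Eucl d}
    (hg : IsWeakGradient Ω u g) :
    weakGradient Ω u =ᵐ[volume.restrict (Ω : Set (Eucl d))] g := by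
  have h : ∃ g, IsWeakGradient Ω u g := ⟨g, hg⟩
  rw [weakGradient, dif_pos h]
  exact h.choose_spec.ae_eq hg

theorem MemW1p.isWeakGradient {p : ℝ≥0∞} {u : Eucl d → ℝ} (hu : MemW1p Ω p u) :
    IsWeakGradient Ω u (weakGradient Ω u) := by
  have h := hu.exists_weakGradient
  rw [weakGradient, dif_pos h]
  exact h.choose_spec

/-- The classical gradient of a Lipschitz function (defined almost everywhere) is its weak
gradient. -/
theorem LipschitzWith.isWeakGradient {f : Eucl d → ℝ} {C : NNReal} (hf : LipschitzWith C f) :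
    IsWeakGradient Ω f (∇ f) where
  locallyIntegrableOn_fun := hf.continuous.locallyIntegrable.locallyIntegrableOn _
  locallyIntegrableOn_grad := by
    have h : MemLp (∇ f) ∞ := memLp_top_of_bound (measurable_gradient f).aestronglyMeasurable C
      (Filter.Eventually.of_forall hf.norm_gradient_le)
    exact (h.locallyIntegrable le_top).locallyIntegrableOn _
  integral_eq φ := by
    have hf1 := integrableOn_smul_gradient
      (hf.continuous.locallyIntegrable.locallyIntegrableOn (Ω : Set (Eucl d))) φ
    have h : MemLp (∇ f) ∞ := memLp_top_of_bound (measurable_gradient f).aestronglyMeasurable C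
      (Filter.Eventually.of_forall hf.norm_gradient_le)
    have hf2 := integrableOn_testFunction_smul
      ((h.locallyIntegrable le_top).locallyIntegrableOn (Ω : Set (Eucl d))) φ
    obtain ⟨D, hD⟩ := φ.exists_lipschitzWith
    have hφ0 : ∀ x, x ∉ (Ω : Set (Eucl d)) → φ x = 0 := fun x hx =>
      image_eq_zero_of_notMem_tsupport fun h => hx (φ.tsupport_subset h)
    have hgφ0 : ∀ x, x ∉ (Ω : Set (Eucl d)) → ∇ (φ : Eucl d → ℝ) x = 0 := fun x hx =>
      image_eq_zero_of_notMem_tsupport fun h =>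
        hx (φ.tsupport_subset (tsupport_gradient_subset _ h))
    refine ext_inner_left ℝ fun v => ?_
    rw [inner_neg_right, ← integral_inner hf1, ← integral_inner hf2]
    rw [setIntegral_eq_integral_of_forall_compl_eq_zero fun x hx => by simp [hgφ0 x hx],
      setIntegral_eq_integral_of_forall_compl_eq_zero fun x hx => by simp [hφ0 x hx]]
    -- Paired with a fixed `v`, the claim is integration by parts for line derivatives of Lipschitz
    -- functions; Rademacher's theorem identifies these with the gradient almost everywhere.
    have key := integral_lineDeriv_mul_eq (μ := (volume : Measure (Eucl d)))
      hf hD φ.hasCompactSupport v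
    have e1 : ∫ x, lineDeriv ℝ f x v * φ x = ∫ x, inner ℝ v (φ x • ∇ f x) := by
      refine integral_congr_ae ?_
      filter_upwards [hf.ae_differentiableAt] with x hx
      rw [inner_smul_right, inner_gradient, hx.lineDeriv_eq_fderiv, mul_comm]
    have e2 : ∫ x, lineDeriv ℝ φ x (-v) * f x
        = -∫ x, inner ℝ v (f x • ∇ (φ : Eucl d → ℝ) x) := by
      rw [← integral_neg]
      refine integral_congr_ae (Filter.Eventually.of_forall fun x => ?_)
      have hx : DifferentiableAt ℝ φ x := φ.contDiff.differentiable (by simp) x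
      simp only [inner_smul_right, inner_gradient, hx.lineDeriv_eq_fderiv, map_neg]
      ring
    rw [← e1, key, e2, neg_neg]

end weak

/-! ### The Sobolev norm -/

section norm

variable {d : ℕ} {Ω : Opens (Eucl d)} {p : ℝ≥0∞} {u : Eucl d → ℝ} {g : Eucl d → Eucl d}

theorem one_le_toReal (hp : 1 ≤ p) (hp' : p ≠ ∞) : 1 ≤ p.toReal := by
  rw [← ENNReal.toReal_one]
  exact ENNReal.toReal_mono hp' hp

/-- The ℓ^p norm of two numbers is at most their sum, and any weak gradient may replace the chosen
one. -/
theorem w1pNorm_le_add (hp : 1 ≤ p) (hp' : p ≠ ∞) (hg : IsWeakGradient Ω u g) :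
    w1pNorm Ω p u ≤ eLpNorm u p (volume.restrict (Ω : Set (Eucl d)))
      + eLpNorm g p (volume.restrict (Ω : Set (Eucl d))) := by
  have hq := one_le_toReal hp hp'
  rw [w1pNorm, eLpNorm_congr_ae hg.weakGradient_ae_eq, one_div,
    ENNReal.rpow_inv_le_iff (by positivity)]
  exact ENNReal.add_rpow_le_rpow_add _ _ hq

theorem eLpNorm_le_w1pNorm (hp : 1 ≤ p) (hp' : p ≠ ∞) :
    eLpNorm u p (volume.restrict (Ω : Set (Eucl d))) ≤ w1pNorm Ω p u := by
  have hq := one_le_toReal hp hp'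
  rw [w1pNorm, one_div, ENNReal.le_rpow_inv_iff (by positivity)]
  exact le_self_add

theorem eLpNorm_weakGradient_le_w1pNorm (hp : 1 ≤ p) (hp' : p ≠ ∞)
    (hg : IsWeakGradient Ω u g) :
    eLpNorm g p (volume.restrict (Ω : Set (Eucl d))) ≤ w1pNorm Ω p u := by
  have hq := one_le_toReal hp hp'
  rw [← eLpNorm_congr_ae hg.weakGradient_ae_eq, w1pNorm, one_div,
    ENNReal.le_rpow_inv_iff (by positivity)]
  exact le_add_self

/-- The `W^{1,p}(Ω)` distance of two Lipschitz functions is controlled by the `L^p` distances of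
the functions and of their gradients. -/
theorem LipschitzWith.w1pNorm_sub_le {f h : Eucl d → ℝ} {C D : NNReal} (hp : 1 ≤ p) (hp' : p ≠ ∞)
    (hf : LipschitzWith C f) (hh : LipschitzWith D h) :
    w1pNorm Ω p (f - h) ≤ eLpNorm (f - h) p + eLpNorm (∇ f - ∇ h) p :=
  (w1pNorm_le_add hp hp' (hf.isWeakGradient.sub hh.isWeakGradient)).trans
    (add_le_add (eLpNorm_mono_measure _ Measure.restrict_le_self)
      (eLpNorm_mono_measure _ Measure.restrict_le_self))

/-- A triangle inequality, up to a constant, for the `W^{1,p}(Ω)` norm. -/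
theorem w1pNorm_sub_le_two_mul {v w : Eucl d → ℝ} {k l : Eucl d → Eucl d} (hp : 1 ≤ p)
    (hp' : p ≠ ∞) (hu : IsWeakGradient Ω u g) (hv : IsWeakGradient Ω v k)
    (hw : IsWeakGradient Ω w l) :
    w1pNorm Ω p (u - w) ≤ 2 * (w1pNorm Ω p (u - v) + w1pNorm Ω p (v - w)) := by
  have huv := hu.sub hv
  have hvw := hv.sub hw
  have e1 : u - w = (u - v) + (v - w) := by abel
  have e2 : g - l = (g - k) + (k - l) := by abel
  -- Each of the two L^p norms is bounded by the full Sobolev norm, whence the factor 2; it is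
  -- harmless here.
  refine (w1pNorm_le_add hp hp' (hu.sub hw)).trans ?_
  rw [e1, e2, two_mul]
  refine add_le_add ((eLpNorm_add_le ?_ ?_ hp).trans ?_) ((eLpNorm_add_le ?_ ?_ hp).trans ?_)
  · exact huv.locallyIntegrableOn_fun.aestronglyMeasurable
  · exact hvw.locallyIntegrableOn_fun.aestronglyMeasurable
  · exact add_le_add (eLpNorm_le_w1pNorm hp hp') (eLpNorm_le_w1pNorm hp hp')
  · exact huv.locallyIntegrableOn_grad.aestronglyMeasurable
  · exact hvw.locallyIntegrableOn_grad.aestronglyMeasurable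
  · exact add_le_add (eLpNorm_weakGradient_le_w1pNorm hp hp' huv)
      (eLpNorm_weakGradient_le_w1pNorm hp hp' hvw)

end norm

/-! ### Mollification of Lipschitz functions with compact support -/

section mollify

open Filter Metric
open scoped Convolution Topology

variable {d : ℕ} {F : Type*} [NormedAddCommGroup F] [NormedSpace ℝ F]

/-- The mollification of `g` by the normalized bump function `η`. -/
noncomputable def mollify (η : ContDiffBump (0 : Eucl d)) (g : Eucl d → F) : Eucl d → F :=
  η.normed volume ⋆[ContinuousLinearMap.lsmul ℝ ℝ, volume] g

theorem mollify_eq_zero [CompleteSpace F] {η : ContDiffBump (0 : Eucl d)} {g : Eucl d → F} {K : Set (Eucl d)} {δ : ℝ}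
    (hg : ∀ x ∉ K, g x = 0) (hη : η.rOut ≤ δ) {x : Eucl d} (hx : x ∉ cthickening δ K) :
    mollify η g x = 0 := by
  have h : ∀ y ∈ ball x η.rOut, g y = 0 := by
    intro y hy
    refine hg y fun hyK => hx (mem_cthickening_of_dist_le x y δ K hyK ?_)
    rw [dist_comm]
    exact (mem_ball.1 hy).le.trans hη
  have hx0 := h x (mem_ball_self η.rOut_pos)
  rw [mollify, ContDiffBump.normed_convolution_eq_right fun y hy => (h y hy).trans hx0.symm, hx0]

theorem norm_mollify_le {η : ContDiffBump (0 : Eucl d)} {g : Eucl d → F} {M : ℝ}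
    (hg : ∀ x, ‖g x‖ ≤ M) (x : Eucl d) : ‖mollify η g x‖ ≤ M := by
  have h : ‖∫ t, η.normed volume t • g (x - t)‖ ≤ ∫ t, η.normed volume t * M := by
    refine norm_integral_le_of_norm_le (η.integrable_normed.mul_const M)
      (Eventually.of_forall fun t => ?_)
    rw [norm_smul, Real.norm_of_nonneg (η.nonneg_normed t)]
    exact mul_le_mul_of_nonneg_left (hg _) (η.nonneg_normed t)
  rw [integral_mul_const, η.integral_normed, one_mul] at h
  exact h

theorem continuous_mollify (η : ContDiffBump (0 : Eucl d)) {g : Eucl d → F}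
    (hg : LocallyIntegrable g) : Continuous (mollify η g) :=
  η.hasCompactSupport_normed.continuous_convolution_left _ η.continuous_normed hg

/-- Mollifications of a bounded function vanishing outside of a compact set converge in `L^p`. -/
theorem tendsto_eLpNorm_mollify_sub [CompleteSpace F] {p : ℝ≥0∞} (hp : 1 ≤ p) (hp' : p ≠ ∞)
    {g : Eucl d → F} {M : ℝ} {K : Set (Eucl d)} (hK : IsCompact K) (hM : ∀ x, ‖g x‖ ≤ M) (hgK : ∀ x ∉ K, g x = 0)
    (hg : LocallyIntegrable g) {η : ℕ → ContDiffBump (0 : Eucl d)}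
    (hη : Tendsto (fun n => (η n).rOut) atTop (𝓝 0)) (hη1 : ∀ n, (η n).rOut ≤ 1)
    (hη2 : ∀ n, (η n).rOut ≤ 2 * (η n).rIn) :
    Tendsto (fun n => eLpNorm (mollify (η n) g - g) p) atTop (𝓝 0) := by
  have hp0 : p ≠ 0 := (zero_lt_one.trans_le hp).ne'
  have hq : 0 < p.toReal := ENNReal.toReal_pos hp0 hp'
  have hM0 : 0 ≤ M := (norm_nonneg _).trans (hM 0)
  let K1 := cthickening 1 K
  have hK1 : IsCompact K1 := hK.cthickening
  have hlim : Tendsto (fun n => ∫⁻ x, ‖(mollify (η n) g - g) x‖ₑ ^ p.toReal) atTop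
      (𝓝 (∫⁻ _ : Eucl d, 0)) := by
    refine tendsto_lintegral_of_dominated_convergence'
      (K1.indicator fun _ => ENNReal.ofReal (2 * M) ^ p.toReal) ?_ ?_ ?_ ?_
    · intro n
      exact (((continuous_mollify (η n) hg).aestronglyMeasurable.sub
        hg.aestronglyMeasurable).enorm).pow_const _
    · refine fun n => Eventually.of_forall fun x => ?_
      by_cases hx : x ∈ K1
      · rw [Set.indicator_of_mem hx]
        refine ENNReal.rpow_le_rpow ?_ hq.le
        rw [← ofReal_norm]
        refine ENNReal.ofReal_le_ofReal ((norm_sub_le _ _).trans ?_)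
        linarith [norm_mollify_le (η := η n) hM x, hM x]
      · have h1 : mollify (η n) g x = 0 := mollify_eq_zero hgK (hη1 n) hx
        have h2 : g x = 0 := hgK x fun h => hx (self_subset_cthickening K h)
        simp [h1, h2, hq]
    · rw [lintegral_indicator hK1.measurableSet, setLIntegral_const]
      exact ENNReal.mul_ne_top (ENNReal.rpow_ne_top_of_nonneg hq.le ENNReal.ofReal_ne_top)
        hK1.measure_lt_top.ne
    · filter_upwards [ContDiffBump.ae_convolution_tendsto_right_of_locallyIntegrable hη
        (Eventually.of_forall hη2) hg] with x hx
      have h1 : Tendsto (fun n => ‖(mollify (η n) g - g) x‖ₑ) atTop (𝓝 0) := by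
        have := (hx.sub_const (g x)).enorm
        rwa [sub_self, enorm_zero] at this
      have := h1.ennrpow_const p.toReal
      rwa [ENNReal.zero_rpow_of_pos hq] at this
  rw [lintegral_zero] at hlim
  have := hlim.ennrpow_const (1 / p.toReal)
  rw [ENNReal.zero_rpow_of_pos (by positivity)] at this
  simpa only [eLpNorm_eq_lintegral_rpow_enorm_toReal hp0 hp'] using this

/-- The derivative is put on `f` rather than on the bump, so that convergence of gradients is again
convergence of mollifications. Difference quotients are dominated by the Lipschitz constant. -/
theorem LipschitzWith.hasFDerivAt_mollify {f : Eucl d → ℝ} {C : NNReal} (hf : LipschitzWith C f)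
    (η : ContDiffBump (0 : Eucl d)) (x : Eucl d) :
    HasFDerivAt (mollify η f) (mollify η (fderiv ℝ f) x) x := by
  have hd : ∀ᵐ t, DifferentiableAt ℝ f (x - t) :=
    (quasiMeasurePreserving_sub_left volume x).ae hf.ae_differentiableAt
  refine (hasFDerivAt_integral_of_dominated_loc_of_lip (μ := volume)
    (F := fun y t => η.normed volume t • f (y - t))
    (F' := fun t => η.normed volume t • fderiv ℝ f (x - t))
    (bound := fun t => η.normed volume t * C) univ_mem ?_ ?_ ?_ ?_ ?_ ?_).2
  · refine Eventually.of_forall fun y => ?_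
    exact (η.continuous_normed.smul
      (hf.continuous.comp (continuous_const.sub continuous_id))).aestronglyMeasurable
  · refine Continuous.integrable_of_hasCompactSupport
      (η.continuous_normed.smul (hf.continuous.comp (continuous_const.sub continuous_id))) ?_
    exact η.hasCompactSupport_normed.smul_right
  · exact (η.continuous_normed.measurable.smul
      ((measurable_fderiv ℝ f).comp (measurable_const.sub measurable_id))).aestronglyMeasurable
  · refine Eventually.of_forall fun t => (LipschitzWith.of_dist_le_mul fun y z => ?_).lipschitzOnWith
    rw [Real.dist_eq, ← smul_sub, smul_eq_mul, abs_mul, Real.coe_nnabs, abs_mul,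
      abs_of_nonneg C.coe_nonneg, mul_assoc]
    refine mul_le_mul_of_nonneg_left ?_ (abs_nonneg _)
    have := hf.dist_le_mul (y - t) (z - t)
    rwa [dist_sub_right, Real.dist_eq] at this
  · exact η.integrable_normed.mul_const _
  · filter_upwards [hd] with t ht
    have h1 : HasFDerivAt (fun y => f (y - t)) (fderiv ℝ f (x - t)) x :=
      ht.hasFDerivAt.comp x ((hasFDerivAt_id x).sub_const t)
    exact h1.const_smul (η.normed volume t)

/-- Lipschitz functions with compact support in `Ω` belong to `W^{1,p}_0(Ω)`. -/
theorem LipschitzWith.memW01p {Ω : Opens (Eucl d)} {p : ℝ≥0∞} (hp : 1 ≤ p) (hp' : p ≠ ∞)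
    {f : Eucl d → ℝ} {C : NNReal} (hf : LipschitzWith C f) (hc : HasCompactSupport f)
    (hΩ : tsupport f ⊆ Ω) : MemW01p Ω p f where
  memW1p :=
    { memLp := (hf.continuous.memLp_of_hasCompactSupport hc).restrict _
      exists_weakGradient := ⟨_, hf.isWeakGradient⟩
      memLp_weakGradient := ((hf.memLp_gradient hc p).restrict _).ae_eq
        hf.isWeakGradient.weakGradient_ae_eq.symm }
  mem_closure ε hε := by
    have hK : IsCompact (tsupport f) := hc
    obtain ⟨δ, hδ, hδΩ⟩ := hK.exists_cthickening_subset_open Ω.isOpen hΩ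
    -- The bound δ keeps supports inside Ω; the bound 1 gives one compact set for dominated
    -- convergence.
    let r : ℕ → ℝ := fun n => min δ 1 / (n + 1)
    have hδ1 : 0 < min δ 1 := lt_min hδ one_pos
    have hr : ∀ n, 0 < r n := fun n => by positivity
    have hrle : ∀ n, r n ≤ min δ 1 := fun n =>
      div_le_self hδ1.le (by linarith [n.cast_nonneg (α := ℝ)])
    let η : ℕ → ContDiffBump (0 : Eucl d) := fun n =>
      ⟨r n / 2, r n, half_pos (hr n), half_lt_self (hr n)⟩
    have hη : Tendsto (fun n => (η n).rOut) atTop (𝓝 0) := by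
      have := (tendsto_one_div_add_atTop_nhds_zero_nat (𝕜 := ℝ)).const_mul (min δ 1)
      simpa only [mul_zero, mul_one_div] using this
    have hη1 : ∀ n, (η n).rOut ≤ 1 := fun n => (hrle n).trans (min_le_right _ _)
    have hη2 : ∀ n, (η n).rOut ≤ 2 * (η n).rIn := fun n => by
      change r n ≤ 2 * (r n / 2)
      linarith
    have hli : LocallyIntegrable f := hf.continuous.locallyIntegrable
    have hli' : LocallyIntegrable (fderiv ℝ f) := by
      have h : MemLp (fderiv ℝ f) ∞ := memLp_top_of_bound
        (measurable_fderiv ℝ f).aestronglyMeasurable C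
        (Eventually.of_forall fun x => norm_fderiv_le_of_lipschitz ℝ hf)
      exact h.locallyIntegrable le_top
    obtain ⟨B, hB⟩ := hf.continuous.bounded_above_of_compact_support hc
    have hf0 : ∀ x ∉ tsupport f, f x = 0 := fun x hx => image_eq_zero_of_notMem_tsupport hx
    have hf0' : ∀ x ∉ tsupport f, fderiv ℝ f x = 0 := fun x hx =>
      image_eq_zero_of_notMem_tsupport fun h => hx (tsupport_fderiv_subset ℝ h)
    have hψ : ∀ n, ∀ x ∉ cthickening δ (tsupport f), mollify (η n) f x = 0 := fun n x hx =>
      mollify_eq_zero hf0 ((hrle n).trans (min_le_left _ _)) hx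
    have hψs : ∀ n, tsupport (mollify (η n) f) ⊆ cthickening δ (tsupport f) := fun n =>
      closure_minimal (fun x hx => by_contra fun h => hx (hψ n x h)) isClosed_cthickening
    let ψ : ℕ → 𝓓(Ω, ℝ) := fun n =>
      { toFun := mollify (η n) f
        contDiff' := (η n).hasCompactSupport_normed.contDiff_convolution_left _
          (η n).contDiff_normed hli
        hasCompactSupport' := hK.cthickening.of_isClosed_subset (isClosed_tsupport _) (hψs n)
        tsupport_subset' := (hψs n).trans hδΩ }
    have h1 := tendsto_eLpNorm_mollify_sub hp hp' hK hB hf0 hli hη hη1 hη2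
    have h2 := tendsto_eLpNorm_mollify_sub hp hp' hK
      (fun x => norm_fderiv_le_of_lipschitz ℝ hf (x₀ := x)) hf0' hli' hη hη1 hη2
    have h3 := h1.add h2
    rw [add_zero] at h3
    obtain ⟨n, hn⟩ := (h3.eventually (gt_mem_nhds (ENNReal.ofReal_pos.2 hε))).exists
    refine ⟨ψ n, ?_⟩
    obtain ⟨D, hD⟩ := (ψ n).exists_lipschitzWith
    refine (hf.w1pNorm_sub_le hp hp' hD).trans_lt (lt_of_eq_of_lt ?_ hn)
    congr 1
    · exact eLpNorm_sub_comm _ _ _ _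
    · rw [eLpNorm_sub_comm]
      refine eLpNorm_congr_norm_ae (Eventually.of_forall fun x => ?_)
      rw [Pi.sub_apply, norm_gradient_sub_gradient, Pi.sub_apply,
        (hf.hasFDerivAt_mollify (η n) x).fderiv.symm]
      rfl

end mollify

/-! ### Approximation of smooth functions by maxima of tangents

If `2 K |x|²` is added to a function `φ` with `|D²φ| ≤ K`, the sum is uniformly convex, and so it is
approximated together with its gradient by the maximum of its tangents at the points of a fine
net. -/

section tangent

open Metric

variable {d : ℕ} {φ : Eucl d → ℝ} {K : ℝ} {t : Finset (Eucl d)}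

/-- Parameters of the tangent of `x ↦ φ x + 2 K |x|²` at `y`. -/
noncomputable def tangentParam (φ : Eucl d → ℝ) (K : ℝ) (y : Eucl d) : Eucl d × ℝ :=
  (∇ φ y + (4 * K) • y, φ y - inner ℝ (∇ φ y) y - 2 * K * ‖y‖ ^ 2)

open Classical in
/-- The maximum of the tangents of `x ↦ φ x + 2 K |x|²` at the points of `t`. -/
noncomputable def tangentMax (φ : Eucl d → ℝ) (K : ℝ) (t : Finset (Eucl d)) : Eucl d → ℝ :=
  maxAffine (t.image (tangentParam φ K))

/-- `φ` and its first order Taylor expansions differ by at most `K |x - y|²`, and `∇ φ` is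
`K`-Lipschitz. -/
structure HasTaylorBound (φ : Eucl d → ℝ) (K : ℝ) : Prop where
  abs_sub_le : ∀ x y, |φ x - φ y - inner ℝ (∇ φ y) (x - y)| ≤ K * ‖x - y‖ ^ 2
  norm_gradient_sub_le : ∀ x y, ‖∇ φ x - ∇ φ y‖ ≤ K * ‖x - y‖

theorem affineVal_tangentParam (φ : Eucl d → ℝ) (K : ℝ) (x y : Eucl d) :
    affineVal (tangentParam φ K y) x
      = φ y + inner ℝ (∇ φ y) (x - y) + 2 * K * (‖x‖ ^ 2 - ‖x - y‖ ^ 2) := by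
  rw [norm_sub_sq_real, affineVal, tangentParam, inner_add_left, real_inner_smul_left,
    inner_sub_right, real_inner_comm y x]
  ring

theorem tangentParam_congr {ψ : Eucl d → ℝ} {y : Eucl d} (h : φ y = ψ y) (h' : ∇ φ y = ∇ ψ y) :
    tangentParam φ K y = tangentParam ψ K y := by
  rw [tangentParam, tangentParam, h, h']

/-- The quadratic contributes a gap of exactly 2K|x − y|², and the Taylor error of `φ` changes it by
at most K|x − y|²: the gap lies between K and 3K times |x − y|². -/
theorem HasTaylorBound.le_sub_tangent (hφ : HasTaylorBound φ K) (x y : Eucl d) :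
    K * ‖x - y‖ ^ 2 ≤ φ x + 2 * K * ‖x‖ ^ 2 - affineVal (tangentParam φ K y) x := by
  rw [affineVal_tangentParam]
  linarith [(abs_le.1 (hφ.abs_sub_le x y)).1]

theorem HasTaylorBound.sub_tangent_le (hφ : HasTaylorBound φ K) (x y : Eucl d) :
    φ x + 2 * K * ‖x‖ ^ 2 - affineVal (tangentParam φ K y) x ≤ 3 * K * ‖x - y‖ ^ 2 := by
  rw [affineVal_tangentParam]
  linarith [(abs_le.1 (hφ.abs_sub_le x y)).2]

theorem affineVal_le_tangentMax {y : Eucl d} (hy : y ∈ t) (x : Eucl d) :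
    affineVal (tangentParam φ K y) x ≤ tangentMax φ K t x := by
  classical
  exact affineVal_le_maxAffine (Finset.mem_image_of_mem _ hy) x

/-- An active tangent has the smallest gap, so K|x − y|² ≤ 3K|x − z|², and √3 ≤ 2. -/
theorem HasTaylorBound.exists_active (hφ : HasTaylorBound φ K) (hK : 0 < K) (ht : t.Nonempty)
    (x : Eucl d) : ∃ y ∈ t, tangentMax φ K t x = affineVal (tangentParam φ K y) x ∧
      ∀ z ∈ t, ‖x - y‖ ≤ 2 * ‖x - z‖ := by
  classical
  obtain ⟨s, hs, e⟩ := exists_maxAffine_eq (ht.image (tangentParam φ K)) x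
  obtain ⟨y, hy, rfl⟩ := Finset.mem_image.1 hs
  refine ⟨y, hy, e, fun z hz => ?_⟩
  have h1 := hφ.le_sub_tangent x y
  have h2 := hφ.sub_tangent_le x z
  have h3 : affineVal (tangentParam φ K z) x ≤ affineVal (tangentParam φ K y) x :=
    (affineVal_le_tangentMax hz x).trans e.le
  have h4 : K * ‖x - y‖ ^ 2 ≤ K * (3 * ‖x - z‖ ^ 2) := by linarith
  have h5 := le_of_mul_le_mul_left h4 hK
  refine le_of_sq_le_sq ?_ (by positivity)
  nlinarith [sq_nonneg ‖x - z‖]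

theorem HasTaylorBound.abs_sub_tangentMax_le (hφ : HasTaylorBound φ K) (hK : 0 < K) {z : Eucl d}
    (hz : z ∈ t) (x : Eucl d) :
    |φ x + 2 * K * ‖x‖ ^ 2 - tangentMax φ K t x| ≤ 3 * K * ‖x - z‖ ^ 2 := by
  obtain ⟨y, -, e, -⟩ := hφ.exists_active hK ⟨z, hz⟩ x
  have h1 := hφ.le_sub_tangent x y
  have h2 : 0 ≤ K * ‖x - y‖ ^ 2 := by positivity
  rw [abs_of_nonneg (by rw [e]; linarith)]
  linarith [hφ.sub_tangent_le x z, affineVal_le_tangentMax (φ := φ) (K := K) hz x]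

theorem hasFDerivAt_affineVal (s : Eucl d × ℝ) (x : Eucl d) :
    HasFDerivAt (affineVal s) (innerSL ℝ s.1) x :=
  ((innerSL ℝ s.1).hasFDerivAt).add_const s.2

/-- The gradient of a maximum of affine functions is the gradient of any active one. -/
theorem gradient_maxAffine {S : Finset (Eucl d × ℝ)} {s : Eucl d × ℝ} {x : Eucl d} (hs : s ∈ S)
    (he : maxAffine S x = affineVal s x) (hd : DifferentiableAt ℝ (maxAffine S) x) :
    ∇ (maxAffine S) x = s.1 := by
  -- The maximum minus an active function is nonnegative and vanishes at `x`.
  have hmin : IsLocalMin (maxAffine S - affineVal s) x :=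
    Filter.Eventually.of_forall fun y => by
      rw [Pi.sub_apply, he, sub_self]
      exact sub_nonneg.2 (affineVal_le_maxAffine hs y)
  have h := hmin.hasFDerivAt_eq_zero (hd.hasFDerivAt.sub (hasFDerivAt_affineVal s x))
  refine ext_inner_left ℝ fun v => ?_
  rw [inner_gradient, sub_eq_zero.1 h, innerSL_apply_apply, real_inner_comm]

/-- The gradient is that of φ + 2K|·|² at an active `y`; this field is 5K-Lipschitz, and |x − y| ≤
2|x − z|. -/
theorem HasTaylorBound.norm_gradient_tangentMax_sub_le (hφ : HasTaylorBound φ K) (hK : 0 < K)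
    {z : Eucl d} (hz : z ∈ t) {x : Eucl d} (hd : DifferentiableAt ℝ (tangentMax φ K t) x) :
    ‖∇ (tangentMax φ K t) x - (∇ φ x + (4 * K) • x)‖ ≤ 10 * K * ‖x - z‖ := by
  classical
  obtain ⟨y, hy, e, hyz⟩ := hφ.exists_active hK ⟨z, hz⟩ x
  have hg : ∇ (tangentMax φ K t) x = ∇ φ y + (4 * K) • y :=
    gradient_maxAffine (Finset.mem_image_of_mem _ hy) e hd
  have h1 : ∇ φ y + (4 * K) • y - (∇ φ x + (4 * K) • x)
      = (∇ φ y - ∇ φ x) + (4 * K) • (y - x) := by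
    rw [smul_sub]
    abel
  rw [hg, h1]
  refine (norm_add_le _ _).trans ?_
  have h2 := hφ.norm_gradient_sub_le y x
  rw [norm_smul, Real.norm_of_nonneg (by positivity), norm_sub_rev y x]
  rw [norm_sub_rev y x] at h2
  nlinarith [hyz z hz]

theorem exists_lipschitzWith_tangentMax (ht : t.Nonempty) :
    ∃ C, LipschitzWith C (tangentMax φ K t) := by
  classical
  exact exists_lipschitzWith_maxAffine (ht.image _)

theorem isMaxAffineDiff_tangentMax_sub {ψ : Eucl d → ℝ} (ht : t.Nonempty) :
    IsMaxAffineDiff fun x => tangentMax φ K t x - tangentMax ψ K t x := by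
  classical
  exact ⟨_, _, ht.image _, ht.image _, fun _ => rfl⟩

/-- Locality: the tangent active for `φ` is based near `x`, where it is also a tangent for `ψ`. Used
in both directions with the zero function, this gives exact vanishing off the support. -/
theorem HasTaylorBound.tangentMax_le {ψ : Eucl d → ℝ} (hφ : HasTaylorBound φ K) (hK : 0 < K)
    {z x : Eucl d} (hz : z ∈ t)
    (h : ∀ y, ‖x - y‖ ≤ 2 * ‖x - z‖ → φ y = ψ y ∧ ∇ φ y = ∇ ψ y) :
    tangentMax φ K t x ≤ tangentMax ψ K t x := by
  obtain ⟨y, hy, e, hyz⟩ := hφ.exists_active hK ⟨z, hz⟩ x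
  obtain ⟨h1, h2⟩ := h y (hyz z hz)
  rw [e, tangentParam_congr h1 h2]
  exact affineVal_le_tangentMax hy x

theorem gradient_zero (x : Eucl d) : ∇ (0 : Eucl d → ℝ) x = 0 := by
  rw [← norm_eq_zero, norm_gradient]
  simp

theorem hasTaylorBound_zero (hK : 0 ≤ K) : HasTaylorBound (0 : Eucl d → ℝ) K where
  abs_sub_le x y := by
    simp only [gradient_zero, Pi.zero_apply, inner_zero_left, sub_zero, abs_zero]
    positivity
  norm_gradient_sub_le x y := by
    simp only [gradient_zero, sub_zero, norm_zero]
    positivity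

theorem TestFunction.exists_hasTaylorBound {Ω : Opens (Eucl d)} (φ : 𝓓(Ω, ℝ)) :
    ∃ K, 0 < K ∧ HasTaylorBound (φ : Eucl d → ℝ) K := by
  have hφ : ContDiff ℝ 1 (fderiv ℝ (φ : Eucl d → ℝ)) :=
    (contDiff_infty.1 φ.contDiff 2).fderiv_right (by norm_num)
  obtain ⟨C, hC⟩ := hφ.lipschitzWith_of_hasCompactSupport
    (φ.hasCompactSupport.fderiv (𝕜 := ℝ)) (by simp)
  have hdiff : Differentiable ℝ (φ : Eucl d → ℝ) := φ.contDiff.differentiable (by simp)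
  have hle : ∀ r : ℝ, 0 ≤ r → (C : ℝ) * r ≤ (C + 1) * r := fun r hr => by linarith
  -- The summand 1 only ensures a positive constant.
  refine ⟨C + 1, by positivity, fun x y => ?_, fun x y => ?_⟩
  · have h := (convex_closedBall y ‖x - y‖).norm_image_sub_le_of_norm_fderiv_le' (𝕜 := ℝ)
      (f := φ) (φ := fderiv ℝ φ y) (C := C * ‖x - y‖) (x := y) (y := x) (fun z _ => hdiff z)
      (fun z hz => ?_) (mem_closedBall_self (norm_nonneg _)) (by simp [dist_eq_norm])
    · rw [real_inner_comm, inner_gradient, ← Real.norm_eq_abs]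
      refine h.trans ?_
      rw [mul_assoc, ← sq]
      exact hle _ (sq_nonneg _)
    · refine (hC.norm_sub_le z y).trans (mul_le_mul_of_nonneg_left ?_ C.coe_nonneg)
      rw [← dist_eq_norm]
      exact hz
  · rw [gradient, gradient, ← map_sub, LinearIsometryEquiv.norm_map]
    exact (hC.norm_sub_le x y).trans (hle _ (norm_nonneg _))

end tangent

/-! ### Piecewise affine approximation of test functions -/

section approximation

open Metric

variable {d : ℕ}

theorem norm_le_sum_abs (x : Eucl d) : ‖x‖ ≤ ∑ i, |x i| := by
  conv_lhs => rw [← (EuclideanSpace.basisFun (Fin d) ℝ).sum_repr x]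
  refine (norm_sum_le _ _).trans (Finset.sum_le_sum fun i _ => ?_)
  rw [norm_smul, OrthonormalBasis.norm_eq_one, mul_one]
  simp

theorem sum_abs_le_mul_norm (x : Eucl d) : ∑ i, |x i| ≤ d * ‖x‖ := by
  refine (Finset.sum_le_card_nsmul _ _ ‖x‖ fun i _ => PiLp.norm_apply_le x i).trans ?_
  simp

theorem isMaxAffineDiff_abs_apply (i : Fin d) : IsMaxAffineDiff fun x : Eucl d => |x i| := by
  have h := IsMaxAffineDiff.affine ((EuclideanSpace.single i 1, 0) : Eucl d × ℝ)
  have e : affineVal ((EuclideanSpace.single i 1, 0) : Eucl d × ℝ) = fun x => x i := by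
    funext x
    simp [affineVal, EuclideanSpace.inner_single_left]
  rw [e] at h
  exact h.max h.neg

/-- There is a piecewise affine function with compact support which is large on a given ball. -/
theorem exists_isMaxAffineDiff_cutoff (r B : ℝ) :
    ∃ χ : Eucl d → ℝ, ∃ A, IsMaxAffineDiff χ ∧ (∀ x, 0 ≤ χ x) ∧ r ≤ A ∧
      (∀ x, ‖x‖ ≤ r → B ≤ χ x) ∧ ∀ x, A < ‖x‖ → χ x = 0 := by
  -- On the ball of radius `r` the ℓ¹ norm is at most `d * r`, leaving height `B`; beyond `A` the ℓ¹
  -- norm exceeds `A`.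
  let A := max r (d * r + B)
  refine ⟨fun x => max 0 (A - ∑ i, |x i|), A,
    (IsMaxAffineDiff.const 0).max ((IsMaxAffineDiff.const A).sub
      (IsMaxAffineDiff.sum _ fun i _ => isMaxAffineDiff_abs_apply i)),
    fun x => le_max_left _ _, le_max_left _ _, fun x hx => ?_, fun x hx => ?_⟩
  · refine le_max_of_le_right ?_
    have h1 := sum_abs_le_mul_norm x
    have h2 : (d : ℝ) * ‖x‖ ≤ d * r := mul_le_mul_of_nonneg_left hx d.cast_nonneg
    have h3 : d * r + B ≤ A := le_max_right _ _
    linarith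
  · exact max_eq_left (by linarith [norm_le_sum_abs x])

/-- Test functions are approximated uniformly, together with their gradients, by piecewise affine
functions supported near the support of the test function. -/
theorem TestFunction.exists_isMaxAffineDiff_approx {Ω : Opens (Eucl d)} (φ : 𝓓(Ω, ℝ)) :
    ∃ C : ℝ, 0 ≤ C ∧ ∀ h : ℝ, 0 < h → h ≤ 1 → ∃ f : Eucl d → ℝ, IsMaxAffineDiff f ∧
      (∀ x ∉ cthickening (2 * h) (tsupport φ), f x = 0) ∧
      (∀ x, |φ x - f x| ≤ C * h) ∧ ∀ᵐ x, ‖∇ (φ : Eucl d → ℝ) x - ∇ f x‖ ≤ C * h := by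
  obtain ⟨K, hK, hφ⟩ := φ.exists_hasTaylorBound
  have hcpt : IsCompact (tsupport φ) := φ.hasCompactSupport
  obtain ⟨r, hr⟩ := (hcpt.cthickening (r := 2)).isBounded.subset_closedBall (0 : Eucl d)
  obtain ⟨B, hB⟩ := φ.continuous.bounded_above_of_compact_support φ.hasCompactSupport
  -- The height `B + 6 * K` exceeds |g| for h ≤ 1, so clipping is inactive on radius r + 1, which
  -- contains a neighbourhood of the thickened support.
  obtain ⟨χ, A, hχ, hχ0, hrA, hχB, hχA⟩ :=
    exists_isMaxAffineDiff_cutoff (d := d) (r + 1) (B + 6 * K)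
  refine ⟨20 * K, by positivity, fun h hh hh1 => ?_⟩
  -- The net must cover the whole region where the cutoff may be nonzero; `max A 0` keeps the ball
  -- nonempty.
  obtain ⟨t', -, ht'fin, ht'⟩ :=
    finite_cover_balls_of_compact (isCompact_closedBall (0 : Eucl d) (max A 0)) hh
  obtain ⟨t, rfl⟩ := ht'fin.exists_finset_coe
  have hnear : ∀ x, ‖x‖ ≤ max A 0 → ∃ z ∈ t, ‖x - z‖ ≤ h := fun x hx => by
    obtain ⟨z, hz, hxz⟩ := Set.mem_iUnion₂.1 (ht' (mem_closedBall_zero_iff.2 hx))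
    exact ⟨z, hz, (dist_eq_norm x z) ▸ (mem_ball.1 hxz).le⟩
  have ht : t.Nonempty := by
    obtain ⟨z, hz, -⟩ := hnear 0 (by simp)
    exact ⟨z, hz⟩
  have h0 : HasTaylorBound (0 : Eucl d → ℝ) K := hasTaylorBound_zero hK.le
  let T := cthickening (2 * h) (tsupport φ)
  have hT : IsClosed T := isClosed_cthickening
  have hTr : ∀ x ∈ T, ‖x‖ ≤ r := fun x hx => mem_closedBall_zero_iff.1
    (hr (cthickening_mono (by linarith) _ hx))
  have hφT : ∀ x ∉ T, φ x = 0 := fun x hx =>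
    image_eq_zero_of_notMem_tsupport fun h => hx (self_subset_cthickening _ h)
  let g : Eucl d → ℝ := fun x => tangentMax φ K t x - tangentMax 0 K t x
  have hgφ : ∀ x, ‖x‖ ≤ max A 0 → |φ x - g x| ≤ 6 * K * h := fun x hx => by
    obtain ⟨z, hz, hxz⟩ := hnear x hx
    have h1 := abs_le.1 (hφ.abs_sub_tangentMax_le hK hz x)
    have h2 := abs_le.1 (h0.abs_sub_tangentMax_le hK hz x)
    have h3 : K * ‖x - z‖ ^ 2 ≤ K * h := by
      refine mul_le_mul_of_nonneg_left ?_ hK.le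
      nlinarith [norm_nonneg (x - z)]
    simp only [Pi.zero_apply] at h2
    rw [abs_le]
    constructor <;> simp only [g] <;> linarith
  have hgT : ∀ x, ‖x‖ ≤ max A 0 → x ∉ T → g x = 0 := fun x hx hxT => by
    obtain ⟨z, hz, hxz⟩ := hnear x hx
    have hloc : ∀ y, ‖x - y‖ ≤ 2 * ‖x - z‖ →
        φ y = (0 : Eucl d → ℝ) y ∧ ∇ (φ : Eucl d → ℝ) y = ∇ (0 : Eucl d → ℝ) y := by
      intro y hy
      have hy' : y ∉ tsupport φ := fun hyt => hxT
        (mem_cthickening_of_dist_le x y _ _ hyt (by rw [dist_eq_norm]; linarith))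
      exact ⟨image_eq_zero_of_notMem_tsupport hy', (image_eq_zero_of_notMem_tsupport fun h =>
        hy' (tsupport_gradient_subset _ h)).trans (gradient_zero y).symm⟩
    exact sub_eq_zero.2 (le_antisymm (hφ.tangentMax_le hK hz hloc)
      (h0.tangentMax_le hK hz fun y hy => ⟨(hloc y hy).1.symm, (hloc y hy).2.symm⟩))
  -- Clipping `g` to [−χ, χ] preserves its zeros and kills it outside the region controlled by the
  -- net.
  let f : Eucl d → ℝ := fun x => max (min (g x) (χ x)) (-χ x)
  have hfg : ∀ x, ‖x‖ ≤ r + 1 → f x = g x := fun x hx => by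
    have h1 := abs_le.1 (hgφ x (hx.trans (hrA.trans (le_max_left _ _))))
    have h2 := hχB x hx
    have h3 := abs_le.1 ((Real.norm_eq_abs _).symm.trans_le (hB x))
    have h4 : K * h ≤ K := mul_le_of_le_one_right hK.le hh1
    simp only [f]
    rw [min_eq_left (by linarith), max_eq_left (by linarith)]
  have hfT : ∀ x ∉ T, f x = 0 := fun x hx => by
    simp only [f]
    rcases le_or_gt ‖x‖ (max A 0) with hxA | hxA
    · rw [hgT x hxA hx, min_eq_left (hχ0 x), max_eq_left (neg_nonpos.2 (hχ0 x))]
    · rw [hχA x ((le_max_left _ _).trans_lt hxA), neg_zero]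
      exact max_eq_right (min_le_right _ _)
  refine ⟨f, ((isMaxAffineDiff_tangentMax_sub ht).min hχ).max hχ.neg, hfT, fun x => ?_, ?_⟩
  · by_cases hx : x ∈ T
    · have hxr := hTr x hx
      rw [hfg x (by linarith)]
      refine (hgφ x ((by linarith : ‖x‖ ≤ A).trans (le_max_left _ _))).trans ?_
      nlinarith
    · rw [hfT x hx, hφT x hx, sub_zero, abs_zero]
      positivity
  · obtain ⟨C1, hC1⟩ := exists_lipschitzWith_tangentMax (φ := φ) (K := K) ht
    obtain ⟨C2, hC2⟩ := exists_lipschitzWith_tangentMax (φ := 0) (K := K) ht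
    filter_upwards [hC1.ae_differentiableAt, hC2.ae_differentiableAt] with x hx1 hx2
    by_cases hx : x ∈ T
    · have hxr := hTr x hx
      obtain ⟨z, hz, hxz⟩ := hnear x ((by linarith : ‖x‖ ≤ A).trans (le_max_left _ _))
      have hfx : f =ᶠ[nhds x] g := by
        filter_upwards [isOpen_ball.mem_nhds
          (mem_ball_zero_iff.2 (by linarith : ‖x‖ < r + 1))] with y hy
        exact hfg y (mem_ball_zero_iff.1 hy).le
      have e1 : ∇ f x = ∇ (tangentMax φ K t) x - ∇ (tangentMax 0 K t) x := by
        rw [gradient, gradient, gradient, ← map_sub, hfx.fderiv_eq]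
        exact congrArg _ (fderiv_sub hx1 hx2)
      have h1 := hφ.norm_gradient_tangentMax_sub_le hK hz hx1
      have h2 := h0.norm_gradient_tangentMax_sub_le hK hz hx2
      rw [gradient_zero, zero_add] at h2
      have e2 : ∇ (φ : Eucl d → ℝ) x - ∇ f x
          = (∇ (tangentMax 0 K t) x - (4 * K) • x)
            - (∇ (tangentMax φ K t) x - (∇ (φ : Eucl d → ℝ) x + (4 * K) • x)) := by
        rw [e1]
        abel
      rw [e2]
      refine (norm_sub_le _ _).trans ((add_le_add h2 h1).trans ?_)
      nlinarith
    · have hfx : (φ : Eucl d → ℝ) =ᶠ[nhds x] f := by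
        filter_upwards [hT.isOpen_compl.mem_nhds hx] with y hy
        rw [hφT y hy, hfT y hy]
      have e : ∇ (φ : Eucl d → ℝ) x = ∇ f x := by
        rw [gradient, gradient, hfx.fderiv_eq]
      rw [e, sub_self, norm_zero]
      positivity

theorem eLpNorm_le_of_bound_of_eq_zero {F : Type*} [NormedAddCommGroup F] {p : ℝ≥0∞} (hp : p ≠ 0)
    (hp' : p ≠ ∞) {w : Eucl d → F} {M : ℝ} (hM : 0 ≤ M) {K : Set (Eucl d)}
    (hK : MeasurableSet K) (hwM : ∀ᵐ x, ‖w x‖ ≤ M) (hwK : ∀ x ∉ K, w x = 0) :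
    eLpNorm w p ≤ ENNReal.ofReal M * volume K ^ (1 / p.toReal) := by
  have h : ∀ᵐ x, ‖w x‖ ≤ K.indicator (fun _ => M) x := by
    filter_upwards [hwM] with x hx
    by_cases hxK : x ∈ K
    · rwa [Set.indicator_of_mem hxK]
    · rw [Set.indicator_of_notMem hxK, hwK x hxK, norm_zero]
  refine (eLpNorm_mono_ae_real h).trans ?_
  rw [eLpNorm_indicator_const hK hp hp', Real.enorm_eq_ofReal hM]

/-- Test functions are approximated in `W^{1,p}` by compactly supported piecewise affine
functions. -/
theorem TestFunction.exists_isMaxAffineDiff_w1pNorm_sub_le {Ω : Opens (Eucl d)} {p : ℝ≥0∞}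
    (hp : 1 ≤ p) (hp' : p ≠ ∞) (φ : 𝓓(Ω, ℝ)) {ε : ℝ} (hε : 0 < ε) :
    ∃ f : Eucl d → ℝ, IsMaxAffineDiff f ∧ HasCompactSupport f ∧ tsupport f ⊆ Ω ∧
      w1pNorm Ω p ((φ : Eucl d → ℝ) - f) ≤ ENNReal.ofReal ε := by
  have hp0 : p ≠ 0 := (zero_lt_one.trans_le hp).ne'
  have hcpt : IsCompact (tsupport φ) := φ.hasCompactSupport
  obtain ⟨δ, hδ, hδΩ⟩ := hcpt.exists_cthickening_subset_open Ω.isOpen φ.tsupport_subset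
  obtain ⟨C, hC, hφ⟩ := φ.exists_isMaxAffineDiff_approx
  let T := cthickening δ (tsupport φ)
  have hT : IsCompact T := hcpt.cthickening
  let m := (volume T ^ (1 / p.toReal)).toReal
  have hm : volume T ^ (1 / p.toReal) = ENNReal.ofReal m :=
    (ENNReal.ofReal_toReal (ENNReal.rpow_ne_top_of_nonneg (by positivity)
      hT.measure_lt_top.ne)).symm
  have hm0 : 0 ≤ m := ENNReal.toReal_nonneg
  -- The three bounds serve the approximation lemma, the support in Ω and the error 2Chm ≤ ε; the
  -- summand 1 avoids a zero denominator.
  let h := min 1 (min (δ / 2) (ε / (2 * C * m + 1)))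
  have hh : 0 < h := by positivity
  have hhδ : 2 * h ≤ δ := by
    have : h ≤ δ / 2 := (min_le_right _ _).trans (min_le_left _ _)
    linarith
  have hhε : 2 * (C * h * m) ≤ ε := by
    have h1 : h ≤ ε / (2 * C * m + 1) := (min_le_right _ _).trans (min_le_right _ _)
    rw [le_div_iff₀ (by positivity)] at h1
    linarith
  obtain ⟨f, hf, hf0, hfφ, hgf⟩ := hφ h hh (min_le_left _ _)
  have hfT : tsupport f ⊆ T := closure_minimal
    (fun x hx => by_contra fun hxT => hx (hf0 x fun h => hxT (cthickening_mono hhδ _ h)))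
    isClosed_cthickening
  have hφT : tsupport φ ⊆ T := self_subset_cthickening _
  obtain ⟨D, hD⟩ := hf.exists_lipschitzWith
  obtain ⟨E, hE⟩ := φ.exists_lipschitzWith
  refine ⟨f, hf, hT.of_isClosed_subset (isClosed_tsupport f) hfT, hfT.trans hδΩ, ?_⟩
  have hCh : 0 ≤ C * h := by positivity
  have h1 : eLpNorm ((φ : Eucl d → ℝ) - f) p ≤ ENNReal.ofReal (C * h * m) := by
    rw [ENNReal.ofReal_mul hCh, ← hm]
    refine eLpNorm_le_of_bound_of_eq_zero hp0 hp' hCh hT.measurableSet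
      (Filter.Eventually.of_forall fun x => hfφ x) fun x hx => ?_
    rw [Pi.sub_apply, image_eq_zero_of_notMem_tsupport fun h => hx (hφT h),
      image_eq_zero_of_notMem_tsupport fun h => hx (hfT h), sub_zero]
  have h2 : eLpNorm (∇ (φ : Eucl d → ℝ) - ∇ f) p ≤ ENNReal.ofReal (C * h * m) := by
    rw [ENNReal.ofReal_mul hCh, ← hm]
    refine eLpNorm_le_of_bound_of_eq_zero hp0 hp' hCh hT.measurableSet hgf fun x hx => ?_
    rw [Pi.sub_apply,
      image_eq_zero_of_notMem_tsupport fun h => hx (hφT (tsupport_gradient_subset _ h)),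
      image_eq_zero_of_notMem_tsupport fun h => hx (hfT (tsupport_gradient_subset _ h)), sub_zero]
  refine (hE.w1pNorm_sub_le hp hp' hD).trans ((add_le_add h1 h2).trans ?_)
  rw [← ENNReal.ofReal_add (by positivity) (by positivity)]
  exact ENNReal.ofReal_le_ofReal (by linarith)

end approximation

theorem theorem2p2 {d : ℕ} (Ω : Opens (Eucl d)) (p : ℝ≥0∞) (hp : 1 ≤ p) (hp' : p ≠ ∞)
    (u : Eucl d → ℝ) (hu : MemW01p Ω p u) (ε : ℝ) (hε : 0 < ε) :
    ∃ uε : Eucl d → ℝ,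
      MemW01p Ω p uε ∧
      RealizedByReLU (⌈Real.logb 2 ((d : ℝ) + 1)⌉₊ + 1) uε ∧
      w1pNorm Ω p (u - uε) ≤ ENNReal.ofReal ε := by
  -- Two errors of ε/4, doubled by the weak triangle inequality, give ε.
  obtain ⟨φ, hφ⟩ := hu.mem_closure (ε / 4) (by positivity)
  obtain ⟨f, hf, hfc, hfΩ, hφf⟩ :=
    φ.exists_isMaxAffineDiff_w1pNorm_sub_le hp hp' (show 0 < ε / 4 by positivity)
  obtain ⟨C, hC⟩ := hf.exists_lipschitzWith
  obtain ⟨D, hD⟩ := φ.exists_lipschitzWith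
  refine ⟨f, hC.memW01p hp hp' hfc hfΩ, hf.realizedByReLU, ?_⟩
  refine (w1pNorm_sub_le_two_mul hp hp' hu.memW1p.isWeakGradient hD.isWeakGradient
    hC.isWeakGradient).trans ?_
  have e : ENNReal.ofReal ε = 2 * (ENNReal.ofReal (ε / 4) + ENNReal.ofReal (ε / 4)) := by
    rw [← ENNReal.ofReal_add (by positivity) (by positivity), ← ENNReal.ofReal_ofNat,
      ← ENNReal.ofReal_mul (by positivity)]
    congr 1
    ring
  rw [e]
  gcongr
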